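/- Let $A$, $B$, $C$ be finite-dimensional quantum systems and let $\rho=\rho^{ABC}$ be a density matrix on $A\otimes B\otimes C$. Write $\|M\|=\mathrm{Tr}\sqrt{M^\dagger M}$ for the trace norm, $F(\rho,\sigma)=\mathrm{Tr}\big(\sqrt{\rho}\,\sigma\sqrt{\rho}\big)^{1/2}$ for the fidelity, and $|\phi^+\rangle=(|00\rangle+|11\rangle)/\sqrt2$. - For a bipartite state $\nu^{XY}$, $D_{\mathrm{LOCC}}^{X:Y}(\nu)$ is the supremum of all $r\ge 0$ for which there are LOCC protocols $\Lambda_n$ between $X^n$ and $Y^n$, with output on $\lfloor nr\rfloor$ pairs of qubits, such that $\frac12\big\|\Lambda_n[\nu^{\otimes n}]-|\phi^+\rangle\langle\phi^+|^{\otimes\lfloor nr\rfloor}\big\|\to0$ as $n\to\infty$. The logarithmic negativity is $E_n^{X:Y}(\nu)=\log_2\|\nu^{T_X}\|$, where $T_X$ is the partial transposition on $X$. - A PPT assisted LOCC operation between parties holding $X$ and $Y$ is a map $\Lambda_{\mathrm{PPT}}[\nu]=\mathrm{Tr}_{\tilde X\tilde Y}\,\Lambda_{\mathrm{LOCC}}[\nu\otimes\mu^{\tilde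 X\tilde Y}]$, where $\mu$ is a state on finite-dimensional systems $\tilde X\tilde Y$ with positive partial transpose and $\Lambda_{\mathrm{LOCC}}$ is an LOCC protocol between $X\tilde X$ and $Y\tilde Y$. - Let $R$ be a register of the same dimension as $B$, held by Charlie together with $C$. The fidelity of PPT quantum state merging is $\mathcal F_{\mathrm{PPT}}(\rho)=\sup F(\sigma_f,\sigma_t)$, where $\sigma_t^{ACR}$ is $\rho^{ABC}$ with $B$ relabelled as $R$, $\sigma_f^{ACR}=\mathrm{Tr}_B\big[\Lambda_{\mathrm{PPT}}[\rho^{ABC}\otimes\tau^{R}]\big]$, and the supremum is over all PPT assisted LOCC operations $\Lambda_{\mathrm{PPT}}$ between $B$ and $CR$ (acting trivially on $A$) and all initial states $\tau^R$ of the register. $\mathcal F_{\mathrm{LOCC}}(\rho)$ is defined in the same way with LOCC protocols between $B$ and $CR$ in place of $\Lambda_{\mathrm{PPT}}$. For $\mathcal F\in\{\mathcal F_{\mathrm{PPT}},\mathcal F_{\mathrm{LOCC}}\}$ put $\mathcal F^\infty(\rho)=\lim_{n\to\infty}\mathcal F(\rho^{\otimes n})$, where $\rho^{\otimes n}$ is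 regarded as a state on $A^{n}B^{n}C^{n}$. Suppose that $\rho$ is distillable between $A$ and $BC$ and has zero logarithmic negativity (equivalently, is PPT) with respect to $AB:C$, i.e. $$D_{\mathrm{LOCC}}^{A:BC}(\rho)>E_n^{AB:C}(\rho)=0 .$$ Then the limits $\mathcal F^\infty_{\mathrm{PPT}}(\rho)$ and $\mathcal F^\infty_{\mathrm{LOCC}}(\rho)$ exist and $$\mathcal F^\infty_{\mathrm{PPT}}(\rho)=0,\qquad \mathcal F^\infty_{\mathrm{LOCC}}(\rho)=0 .$$ -/

import Mathlib

open Filter Topology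
open scoped Kronecker Matrix ComplexOrder

/-! ### States, partial transposition, partial trace

A finite-dimensional quantum system is represented by a finite index type `X` (its computational
basis); operators are matrices `Matrix X X ℂ`, and composite systems are product types. -/

noncomputable section

/-- A density matrix: positive semidefinite with unit trace. -/
def IsState {X : Type} [Fintype X] (ρ : Matrix X X ℂ) : Prop :=
  ρ.PosSemidef ∧ ρ.trace = 1

/-- Partial transposition of the first tensor factor. -/
def partialTranspose {X Y : Type} (M : Matrix (X × Y) (X × Y) ℂ) : Matrix (X × Y) (X × Y) ℂ :=
  Matrix.of fun p q => M (q.1, p.2) (p.1, q.2)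

/-- A bipartite operator has positive partial transpose. -/
def IsPPT {X Y : Type} (M : Matrix (X × Y) (X × Y) ℂ) : Prop :=
  (partialTranspose M).PosSemidef

/-- Partial trace over the first tensor factor. -/
def traceFst {X Y : Type} [Fintype X] (M : Matrix (X × Y) (X × Y) ℂ) : Matrix Y Y ℂ :=
  Matrix.of fun y y' => ∑ x, M (x, y) (x, y')

/-- Partial trace over the second tensor factor. -/
def traceSnd {X Y : Type} [Fintype Y] (M : Matrix (X × Y) (X × Y) ℂ) : Matrix X X ℂ :=
  Matrix.of fun x x' => ∑ y, M (x, y) (x', y)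

/-- The square root of a positive semidefinite matrix, by functional calculus. -/
def matSqrt {X : Type} [Fintype X] [DecidableEq X] (M : Matrix X X ℂ) : Matrix X X ℂ :=
  cfc Real.sqrt M

/-- The trace norm `Tr √(M† M)`. -/
def traceNorm {X : Type} [Fintype X] [DecidableEq X] (M : Matrix X X ℂ) : ℝ :=
  (matSqrt (Mᴴ * M)).trace.re

/-- The trace distance `‖ρ - σ‖ / 2`. -/
def traceDist {X : Type} [Fintype X] [DecidableEq X] (ρ σ : Matrix X X ℂ) : ℝ :=
  traceNorm (ρ - σ) / 2

/-- The (root) fidelity `Tr (√ρ σ √ρ)^{1/2}`. -/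
def fidelity {X : Type} [Fintype X] [DecidableEq X] (ρ σ : Matrix X X ℂ) : ℝ :=
  (matSqrt (matSqrt ρ * σ * matSqrt ρ)).trace.re

/-- The logarithmic negativity `log₂ ‖ρ^{T_X}‖` of an operator on `X : Y`. -/
def logNegativity {X Y : Type} [Fintype X] [DecidableEq X] [Fintype Y] [DecidableEq Y]
    (ρ : Matrix (X × Y) (X × Y) ℂ) : ℝ :=
  Real.logb 2 (traceNorm (partialTranspose ρ))

/-! ### Tensor powers -/

/-- The `n`-th tensor power of a bipartite operator on `X : Y`, as an operator on `Xⁿ : Yⁿ`. -/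
def tensorPow₂ {X Y : Type} (n : ℕ) (ρ : Matrix (X × Y) (X × Y) ℂ) :
    Matrix ((Fin n → X) × (Fin n → Y)) ((Fin n → X) × (Fin n → Y)) ℂ :=
  Matrix.of fun p q => ∏ i, ρ (p.1 i, p.2 i) (q.1 i, q.2 i)

/-- The `n`-th tensor power of a tripartite operator on `A : B : C`, as an operator on
`Aⁿ : Bⁿ : Cⁿ`. -/
def tensorPow₃ {A B C : Type} (n : ℕ) (ρ : Matrix (A × B × C) (A × B × C) ℂ) :
    Matrix ((Fin n → A) × (Fin n → B) × (Fin n → C))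
      ((Fin n → A) × (Fin n → B) × (Fin n → C)) ℂ :=
  Matrix.of fun p q => ∏ i, ρ (p.1 i, p.2.1 i, p.2.2 i) (q.1 i, q.2.1 i, q.2.2 i)

/-! ### LOCC -/

/-- The completely positive map `M ↦ K M K†` with the single Kraus operator `K`. -/
def krausMap {P Q : Type} [Fintype P] (K : Matrix Q P ℂ) :
    Matrix P P ℂ →ₗ[ℂ] Matrix Q Q ℂ where
  toFun M := K * M * Kᴴ
  map_add' M N := by rw [Matrix.mul_add, Matrix.add_mul]
  map_smul' c M := by rw [Matrix.mul_smul, Matrix.smul_mul, RingHom.id_apply]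

/-- Finite-round LOCC protocols between two parties, as linear maps from operators on `X : Y` to
operators on `X' : Y'`. Either nothing is done; or one of the parties performs a local measurement
with Kraus operators `K i` (possibly changing the dimension of the local system), announces the
outcome `i`, and both continue with an LOCC protocol `Λ i` that may depend on `i`. Local ancillas,
discarding of local systems, coarse-grained measurements and local channels are all covered by this
(for outcomes that are not to be used, take `Λ i` independent of `i`). -/
inductive IsLOCC {X' Y' : Type} [Fintype X'] [DecidableEq X'] [Fintype Y'] [DecidableEq Y'] :
    ∀ {X Y : Type} [Fintype X] [DecidableEq X] [Fintype Y] [DecidableEq Y],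
      (Matrix (X × Y) (X × Y) ℂ →ₗ[ℂ] Matrix (X' × Y') (X' × Y') ℂ) → Prop
  | refl : IsLOCC (LinearMap.id : Matrix (X' × Y') (X' × Y') ℂ →ₗ[ℂ] Matrix (X' × Y') (X' × Y') ℂ)
  | fst {X Y : Type} [Fintype X] [DecidableEq X] [Fintype Y] [DecidableEq Y]
      {ι : Type} [Fintype ι] {Z : ι → Type} [∀ i, Fintype (Z i)] [∀ i, DecidableEq (Z i)]
      (K : ∀ i, Matrix (Z i) X ℂ) (hK : ∑ i, (K i)ᴴ * K i = 1)
      (Λ : ∀ i, Matrix (Z i × Y) (Z i × Y) ℂ →ₗ[ℂ] Matrix (X' × Y') (X' × Y') ℂ)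
      (hΛ : ∀ i, IsLOCC (Λ i)) :
      IsLOCC (∑ i, Λ i ∘ₗ krausMap (K i ⊗ₖ (1 : Matrix Y Y ℂ)))
  | snd {X Y : Type} [Fintype X] [DecidableEq X] [Fintype Y] [DecidableEq Y]
      {ι : Type} [Fintype ι] {Z : ι → Type} [∀ i, Fintype (Z i)] [∀ i, DecidableEq (Z i)]
      (K : ∀ i, Matrix (Z i) Y ℂ) (hK : ∑ i, (K i)ᴴ * K i = 1)
      (Λ : ∀ i, Matrix (X × Z i) (X × Z i) ℂ →ₗ[ℂ] Matrix (X' × Y') (X' × Y') ℂ)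
      (hΛ : ∀ i, IsLOCC (Λ i)) :
      IsLOCC (∑ i, Λ i ∘ₗ krausMap ((1 : Matrix X X ℂ) ⊗ₖ K i))

/-- PPT assisted LOCC: `Λ ρ = Tr_{X̃Ỹ} (Λ₀ (ρ ⊗ μ))` for some PPT state `μ` on finite-dimensional
systems `X̃ : Ỹ` and some LOCC protocol `Λ₀` between the parties holding `X X̃` and `Y Ỹ`. -/
def IsPPTAssistedLOCC {X Y : Type} [Fintype X] [DecidableEq X] [Fintype Y] [DecidableEq Y]
    (Λ : Matrix (X × Y) (X × Y) ℂ →ₗ[ℂ] Matrix (X × Y) (X × Y) ℂ) : Prop :=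
  ∃ (X₁ Y₁ : Type) (_ : Fintype X₁) (_ : DecidableEq X₁) (_ : Fintype Y₁) (_ : DecidableEq Y₁)
    (μ : Matrix (X₁ × Y₁) (X₁ × Y₁) ℂ)
    (Λ₀ : Matrix ((X × X₁) × (Y × Y₁)) ((X × X₁) × (Y × Y₁)) ℂ →ₗ[ℂ]
      Matrix ((X × X₁) × (Y × Y₁)) ((X × X₁) × (Y × Y₁)) ℂ),
    IsState μ ∧ IsPPT μ ∧ IsLOCC Λ₀ ∧
      ∀ ρ, Λ ρ = traceSnd
        ((Λ₀ ((ρ ⊗ₖ μ).submatrix (Equiv.prodProdProdComm X X₁ Y Y₁)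
          (Equiv.prodProdProdComm X X₁ Y Y₁))).submatrix
            (Equiv.prodProdProdComm X Y X₁ Y₁) (Equiv.prodProdProdComm X Y X₁ Y₁))

/-! ### Distillable entanglement -/

/-- The density matrix of `|φ⁺⟩ = (|00⟩ + |11⟩)/√2`. -/
def phiPlus : Matrix (Fin 2 × Fin 2) (Fin 2 × Fin 2) ℂ :=
  let ψ : Fin 2 × Fin 2 → ℂ := fun p => if p.1 = p.2 then 1 / (Real.sqrt 2 : ℂ) else 0
  Matrix.vecMulVec ψ (star ψ)

/-- `r` singlets per copy can be distilled from `ρ` by LOCC between `X` and `Y`: there are LOCC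
protocols `Λ n` such that `Λ n (ρ^{⊗n})` approaches `⌊n r⌋` singlets in trace distance. -/
def IsDistillationRate {X Y : Type} [Fintype X] [DecidableEq X] [Fintype Y] [DecidableEq Y]
    (ρ : Matrix (X × Y) (X × Y) ℂ) (r : ℝ) : Prop :=
  0 ≤ r ∧
  ∃ Λ : ∀ n : ℕ,
      Matrix ((Fin n → X) × (Fin n → Y)) ((Fin n → X) × (Fin n → Y)) ℂ →ₗ[ℂ]
        Matrix ((Fin ⌊n * r⌋₊ → Fin 2) × (Fin ⌊n * r⌋₊ → Fin 2))
          ((Fin ⌊n * r⌋₊ → Fin 2) × (Fin ⌊n * r⌋₊ → Fin 2)) ℂ,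
    (∀ n, IsLOCC (Λ n)) ∧
    Tendsto (fun n : ℕ => traceDist (Λ n (tensorPow₂ n ρ)) (tensorPow₂ ⌊n * r⌋₊ phiPlus))
      atTop (𝓝 0)

/-- The LOCC distillable entanglement of `ρ` with respect to `X : Y`, the supremum of all
distillation rates (taken in the extended reals). -/
def distillableEntanglement {X Y : Type} [Fintype X] [DecidableEq X] [Fintype Y] [DecidableEq Y]
    (ρ : Matrix (X × Y) (X × Y) ℂ) : EReal :=
  ⨆ (r : ℝ) (_ : IsDistillationRate ρ r), (r : EReal)

/-! ### Quantum state merging -/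

/-- The same tripartite operator, regarded as an operator on the bipartition `AB : C`. -/
def groupABvsC {A B C : Type} (ρ : Matrix (A × B × C) (A × B × C) ℂ) :
    Matrix ((A × B) × C) ((A × B) × C) ℂ :=
  ρ.submatrix (Equiv.prodAssoc A B C) (Equiv.prodAssoc A B C)

/-- The map `id_S ⊗ Λ`. -/
def idTensor (S : Type) {P Q : Type} (Λ : Matrix P P ℂ →ₗ[ℂ] Matrix Q Q ℂ)
    (M : Matrix (S × P) (S × P) ℂ) : Matrix (S × Q) (S × Q) ℂ :=
  Matrix.of fun u v => Λ (Matrix.of fun p q => M (u.1, p) (v.1, q)) u.2 v.2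

/-- `ρ^{ABC} ⊗ τ^R` as an operator on `A : B : CR`. The register `R` is a copy of `B`. -/
def withRegister {A B C : Type} (ρ : Matrix (A × B × C) (A × B × C) ℂ) (τ : Matrix B B ℂ) :
    Matrix (A × B × (C × B)) (A × B × (C × B)) ℂ :=
  Matrix.of fun p q =>
    ρ (p.1, p.2.1, p.2.2.1) (q.1, q.2.1, q.2.2.1) * τ p.2.2.2 q.2.2.2

/-- The final state `σ_f^{ACR} = Tr_B [(id_A ⊗ Λ) (ρ^{ABC} ⊗ τ^R)]`, where `Λ` acts on `B : CR`. -/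
def finalState {A B C : Type} [Fintype B] (ρ : Matrix (A × B × C) (A × B × C) ℂ)
    (τ : Matrix B B ℂ)
    (Λ : Matrix (B × (C × B)) (B × (C × B)) ℂ →ₗ[ℂ] Matrix (B × (C × B)) (B × (C × B)) ℂ) :
    Matrix (A × (C × B)) (A × (C × B)) ℂ :=
  Matrix.of fun p q => traceFst (Matrix.of fun u v =>
    idTensor A Λ (withRegister ρ τ) (p.1, u) (q.1, v)) p.2 q.2

/-- The target state `σ_t^{ACR}`: the state `ρ^{ABC}` with `B` relabelled as `R`. -/
def targetState {A B C : Type} (ρ : Matrix (A × B × C) (A × B × C) ℂ) :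
    Matrix (A × (C × B)) (A × (C × B)) ℂ :=
  Matrix.of fun p q => ρ (p.1, p.2.2, p.2.1) (q.1, q.2.2, q.2.1)

/-- The optimal merging fidelity of `ρ` when Bob and Charlie may use the operations in `𝓛` and
Charlie may initialise his register in any state (supremum in the extended reals). -/
def mergingFidelity {A B C : Type} [Fintype A] [DecidableEq A] [Fintype B] [DecidableEq B]
    [Fintype C] [DecidableEq C]
    (𝓛 : Set (Matrix (B × (C × B)) (B × (C × B)) ℂ →ₗ[ℂ] Matrix (B × (C × B)) (B × (C × B)) ℂ))
    (ρ : Matrix (A × B × C) (A × B × C) ℂ) : EReal :=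
  ⨆ (Λ ∈ 𝓛) (τ : Matrix B B ℂ) (_ : IsState τ),
    (fidelity (finalState ρ τ Λ) (targetState ρ) : EReal)

/-- The fidelity of PPT quantum state merging. -/
def fidelityPPT {A B C : Type} [Fintype A] [DecidableEq A] [Fintype B] [DecidableEq B]
    [Fintype C] [DecidableEq C] (ρ : Matrix (A × B × C) (A × B × C) ℂ) : EReal :=
  mergingFidelity {Λ | IsPPTAssistedLOCC Λ} ρ

/-- The fidelity of LOCC quantum state merging. -/
def fidelityLOCC {A B C : Type} [Fintype A] [DecidableEq A] [Fintype B] [DecidableEq B]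
    [Fintype C] [DecidableEq C] (ρ : Matrix (A × B × C) (A × B × C) ℂ) : EReal :=
  mergingFidelity {Λ | IsLOCC Λ} ρ

end

/-! Merging would have to create entanglement between Alice and Charlie that Bob and Charlie cannot
create. Since ρ is PPT across AB:C, so is ρ^{⊗n} ⊗ τ across AB:CR. LOCC between B and CR, even
assisted by a PPT state, keeps it PPT, and discarding B leaves a final state that is PPT across A:CR
(`isState_isPPT_finalState`). In the target state Charlie holds B as well, so an LOCC protocol
between A and CR brings it to trace distance ε_n → 0 from m = ⌊nr⌋ singlets, for some r > 0.

The two states are told apart by running this protocol and projecting onto the maximally entangled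
state Φ. In the Heisenberg picture (`IsLOCC.exists_effect`) this is a single effect E. The final
state passes with probability at most 2^{-m}, because LOCC preserves PPT and a PPT state overlaps Φ
by at most 1/d (`re_trace_maxEntangled_mul_le`); the target passes with probability at least 1 -
2ε_n. Fidelity is bounded by the classical fidelity of the outcomes (`fidelity_le`), so it is at
most √(2^{-m}) + √(2ε_n), uniformly in the merging protocol. -/

/-! ### Functional calculus, fidelity and trace norm. -/

theorem continuousOn_spectrum_real {X : Type} [Fintype X] [DecidableEq X] (f : ℝ → ℝ)
    (M : Matrix X X ℂ) : ContinuousOn f (spectrum ℝ M) :=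
  M.finite_real_spectrum.continuousOn f

open scoped MatrixOrder in
theorem posSemidef_cfc {X : Type} [Fintype X] [DecidableEq X] {f : ℝ → ℝ} {M : Matrix X X ℂ}
    (hf : ∀ x ∈ spectrum ℝ M, 0 ≤ f x) : (cfc f M).PosSemidef :=
  Matrix.nonneg_iff_posSemidef.mp (cfc_nonneg hf)

open scoped MatrixOrder in
theorem Matrix.PosSemidef.spectrum_real_nonneg {X : Type} [Fintype X] [DecidableEq X]
    {M : Matrix X X ℂ} (hM : M.PosSemidef) {x : ℝ} (hx : x ∈ spectrum ℝ M) : 0 ≤ x :=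
  spectrum_nonneg_of_nonneg hM.nonneg hx

theorem posSemidef_matSqrt {X : Type} [Fintype X] [DecidableEq X] (M : Matrix X X ℂ) :
    (matSqrt M).PosSemidef :=
  posSemidef_cfc fun x _ => Real.sqrt_nonneg x

theorem matSqrt_mul_self {X : Type} [Fintype X] [DecidableEq X] {M : Matrix X X ℂ}
    (hM : M.PosSemidef) : matSqrt M * matSqrt M = M := by
  have hs : IsSelfAdjoint M := hM.1
  rw [matSqrt, ← cfc_mul _ _ M (continuousOn_spectrum_real _ _) (continuousOn_spectrum_real _ _)]
  conv_rhs => rw [← cfc_id' ℝ M]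
  exact cfc_congr fun x hx => Real.mul_self_sqrt (hM.spectrum_real_nonneg hx)

theorem Matrix.PosSemidef.trace_mul_nonneg {X : Type} [Fintype X] [DecidableEq X]
    {P Q : Matrix X X ℂ} (hP : P.PosSemidef) (hQ : Q.PosSemidef) : 0 ≤ (P * Q).trace := by
  rw [← matSqrt_mul_self hP, Matrix.mul_assoc, Matrix.trace_mul_comm]
  have h := hQ.mul_mul_conjTranspose_same (matSqrt P)
  rw [(posSemidef_matSqrt P).1.eq] at h
  exact h.trace_nonneg

/-- The Cauchy-Schwarz inequality for the Hilbert-Schmidt inner product. -/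
theorem re_trace_conjTranspose_mul_le {X Y : Type} [Fintype X] [Fintype Y] (S T : Matrix X Y ℂ) :
    (Sᴴ * T).trace.re ≤ √((Sᴴ * S).trace.re) * √((Tᴴ * T).trace.re) := by
  have nonneg : ∀ U : Matrix X Y ℂ, 0 ≤ (Uᴴ * U).trace.re := fun U =>
    (Complex.le_def.mp (Matrix.posSemidef_conjTranspose_mul_self U).trace_nonneg).1
  have swap : (Tᴴ * S).trace.re = (Sᴴ * T).trace.re := by
    rw [← Complex.conj_re, ← Complex.star_def, ← Matrix.trace_conjTranspose]
    simp
  have key : ∀ t : ℝ, 0 ≤ (Tᴴ * T).trace.re * (t * t) + (-2 * (Sᴴ * T).trace.re) * t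
      + (Sᴴ * S).trace.re := by
    intro t
    have h := nonneg (S - (t : ℂ) • T)
    simp only [Matrix.conjTranspose_sub, Matrix.conjTranspose_smul, Matrix.sub_mul, Matrix.mul_sub,
      Matrix.trace_sub, Matrix.smul_mul, Matrix.mul_smul, Matrix.trace_smul, Complex.sub_re,
      smul_eq_mul, Complex.star_def, Complex.conj_ofReal, Complex.re_ofReal_mul, swap] at h
    linarith
  have hd := discrim_le_zero key
  rw [discrim] at hd
  rw [← Real.sqrt_mul (nonneg S)]
  exact Real.le_sqrt_of_sq_le (by linarith)

/-- Cauchy-Schwarz for √E P W and Q √E; the contraction W can only shrink the first norm. In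
`fidelity_le`, W is the polar part of √ρ √σ. -/
theorem re_trace_mul_le {X : Type} [Fintype X] [DecidableEq X] {W P Q E : Matrix X X ℂ}
    (hW : (1 - W * Wᴴ).PosSemidef) (hP : P.IsHermitian) (hQ : Q.IsHermitian)
    (hE : E.PosSemidef) :
    (W * (Q * E * P)).trace.re ≤ √((E * (P * P)).trace.re) * √((E * (Q * Q)).trace.re) := by
  set S := matSqrt E with hS
  have hSH : Sᴴ = S := (posSemidef_matSqrt E).1
  have hSS : S * S = E := matSqrt_mul_self hE
  have h := re_trace_conjTranspose_mul_le (S * P * W)ᴴ (Q * S)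
  simp only [Matrix.conjTranspose_conjTranspose, Matrix.conjTranspose_mul, hSH, hP.eq,
    hQ.eq] at h
  have e1 : (S * P * W * (Q * S)).trace = (W * (Q * E * P)).trace := by
    rw [Matrix.mul_assoc (S * P), Matrix.trace_mul_comm (S * P), ← hSS]
    simp only [Matrix.mul_assoc]
  have e2 : (S * Q * (Q * S)).trace = (E * (Q * Q)).trace := by
    rw [Matrix.mul_assoc, Matrix.trace_mul_comm S, Matrix.trace_mul_comm E, ← hSS]
    simp only [Matrix.mul_assoc]
  have e3 : (S * P * W * (Wᴴ * (P * S))).trace.re ≤ (E * (P * P)).trace.re := by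
    have h0 := (hW.mul_mul_conjTranspose_same (S * P)).trace_nonneg
    have e4 : (E * (P * P)).trace - (S * P * W * (Wᴴ * (P * S))).trace
        = (S * P * (1 - W * Wᴴ) * (S * P)ᴴ).trace := by
      rw [Matrix.conjTranspose_mul, hSH, hP.eq, Matrix.mul_sub, Matrix.sub_mul, Matrix.trace_sub,
        Matrix.mul_one]
      congr 1
      · rw [Matrix.mul_assoc, Matrix.trace_mul_comm S, Matrix.trace_mul_comm E, ← hSS]
        simp only [Matrix.mul_assoc]
      · simp only [Matrix.mul_assoc]
    rw [← e4] at h0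
    have := (Complex.le_def.mp h0).1
    simpa using this
  rw [e1, e2] at h
  exact h.trans (mul_le_mul_of_nonneg_right (Real.sqrt_le_sqrt e3) (Real.sqrt_nonneg _))

/-- The fidelity is at most the classical fidelity of the outcome distributions of a two-outcome
measurement. -/
theorem fidelity_le {X : Type} [Fintype X] [DecidableEq X] {ρ σ E : Matrix X X ℂ}
    (hρ : ρ.PosSemidef) (hσ : σ.PosSemidef) (hE : E.PosSemidef) (hE' : (1 - E).PosSemidef) :
    fidelity ρ σ ≤ √((E * ρ).trace.re) * √((E * σ).trace.re)
      + √(((1 - E) * ρ).trace.re) * √(((1 - E) * σ).trace.re) := by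
  set P := matSqrt ρ with hP
  set Q := matSqrt σ with hQ
  have hPH : P.IsHermitian := (posSemidef_matSqrt ρ).1
  have hQH : Q.IsHermitian := (posSemidef_matSqrt σ).1
  have hPP : P * P = ρ := matSqrt_mul_self hρ
  have hQQ : Q * Q = σ := matSqrt_mul_self hσ
  set N := P * σ * P with hN
  have hNp : N.PosSemidef := by
    have := hσ.mul_mul_conjTranspose_same P
    rwa [hPH.eq] at this
  have hNs : IsSelfAdjoint N := hNp.1
  -- G is the pseudo-inverse of √N, since `0⁻¹ = 0` on the kernel. Then √N = G N = (G P Q)(Q P),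
  -- with G P Q a contraction: a polar decomposition without unitaries.
  set G := cfc (fun x : ℝ => (√x)⁻¹) N with hG
  have hGH : Gᴴ = G := (posSemidef_cfc fun x _ => inv_nonneg.mpr (Real.sqrt_nonneg x)).1
  have hGN : matSqrt N = G * N := by
    rw [hG]
    nth_rw 3 [← cfc_id' ℝ N]
    rw [← cfc_mul _ _ N (continuousOn_spectrum_real _ _) (continuousOn_spectrum_real _ _), matSqrt]
    refine cfc_congr fun x hx => ?_
    have hx0 := hNp.spectrum_real_nonneg hx
    rcases hx0.eq_or_lt with rfl | h
    · simp
    · have := (Real.sqrt_pos.mpr h).ne'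
      field_simp
      rw [Real.sq_sqrt hx0]
  have hW : (1 - (G * P * Q) * (G * P * Q)ᴴ).PosSemidef := by
    have e : (G * P * Q) * (G * P * Q)ᴴ = matSqrt N * G := by
      rw [hGN, hN, ← hQQ]
      simp only [Matrix.conjTranspose_mul, hGH, hPH.eq, hQH.eq, Matrix.mul_assoc]
    rw [e, hG, matSqrt,
      ← cfc_mul _ _ N (continuousOn_spectrum_real _ _) (continuousOn_spectrum_real _ _),
      ← cfc_one ℝ N,
      ← cfc_sub _ _ N (continuousOn_spectrum_real _ _) (continuousOn_spectrum_real _ _)]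
    refine posSemidef_cfc fun x _ => ?_
    simpa using mul_inv_le_one
  -- Insert 1 = E + (1 - E) between Q and P.
  have key : fidelity ρ σ = ((G * P * Q) * (Q * E * P)).trace.re
      + ((G * P * Q) * (Q * (1 - E) * P)).trace.re := by
    rw [fidelity, ← hP, ← hN, hGN, ← Complex.add_re, ← Matrix.trace_add, ← Matrix.mul_add,
      ← Matrix.add_mul, ← Matrix.mul_add, add_sub_cancel, Matrix.mul_one, hN, ← hQQ]
    simp only [Matrix.mul_assoc]
  rw [key, ← hPP, ← hQQ]
  exact add_le_add (re_trace_mul_le hW hPH hQH hE) (re_trace_mul_le hW hPH hQH hE')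

theorem fidelity_nonneg {X : Type} [Fintype X] [DecidableEq X] (ρ σ : Matrix X X ℂ) :
    0 ≤ fidelity ρ σ :=
  (Complex.le_def.mp (posSemidef_matSqrt _).trace_nonneg).1

theorem posSemidef_matSqrt_sub {X : Type} [Fintype X] [DecidableEq X] {M : Matrix X X ℂ}
    (hM : M.IsHermitian) : (matSqrt (Mᴴ * M) - M).PosSemidef := by
  have hs : IsSelfAdjoint M := hM
  have e : matSqrt (Mᴴ * M) = cfc (fun x : ℝ => √(x * x)) M := by
    rw [hM.eq, matSqrt]
    conv_lhs => rw [← cfc_id' ℝ M]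
    rw [← cfc_mul _ _ M (continuousOn_spectrum_real _ _) (continuousOn_spectrum_real _ _),
      ← cfc_comp' _ _ M Real.continuous_sqrt.continuousOn (continuousOn_spectrum_real _ _)]
  rw [e]
  nth_rw 2 [← cfc_id' ℝ M]
  rw [← cfc_sub _ _ M (continuousOn_spectrum_real _ _) (continuousOn_spectrum_real _ _)]
  refine posSemidef_cfc fun x _ => ?_
  rw [Real.sqrt_mul_self_eq_abs]
  exact sub_nonneg.mpr (le_abs_self x)

/-- Tr EM ≤ Tr E|M| ≤ Tr |M|, using M ≤ |M| and E ≤ 1. -/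
theorem re_trace_mul_le_traceNorm {X : Type} [Fintype X] [DecidableEq X] {E M : Matrix X X ℂ}
    (hM : M.IsHermitian) (hE : E.PosSemidef) (hE' : (1 - E).PosSemidef) :
    (E * M).trace.re ≤ traceNorm M := by
  have h1 := (Complex.le_def.mp (hE.trace_mul_nonneg (posSemidef_matSqrt_sub hM))).1
  have h2 := (Complex.le_def.mp (hE'.trace_mul_nonneg (posSemidef_matSqrt (Mᴴ * M)))).1
  simp only [Matrix.mul_sub, Matrix.sub_mul, Matrix.one_mul, Matrix.trace_sub, Complex.sub_re,
    Complex.zero_re] at h1 h2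
  rw [traceNorm]
  linarith

/-- |M| - M is positive semidefinite with zero trace, hence zero. -/
theorem posSemidef_of_traceNorm_eq {X : Type} [Fintype X] [DecidableEq X] {M : Matrix X X ℂ}
    (hM : M.IsHermitian) (h : traceNorm M = M.trace.re) : M.PosSemidef := by
  have hp := posSemidef_matSqrt_sub hM
  have h0 : (matSqrt (Mᴴ * M) - M).trace = 0 := by
    have h1 := Complex.le_def.mp hp.trace_nonneg
    refine Complex.ext ?_ h1.2.symm
    rw [Matrix.trace_sub, Complex.sub_re, Complex.zero_re, ← h, traceNorm, sub_self]
  rw [← sub_eq_zero.mp (hp.trace_eq_zero_iff.mp h0)]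
  exact posSemidef_matSqrt _

theorem posSemidef_of_logb_traceNorm {X : Type} [Fintype X] [DecidableEq X] {M : Matrix X X ℂ}
    (hM : M.IsHermitian) (ht : M.trace = 1) (h : Real.logb 2 (traceNorm M) = 0) :
    M.PosSemidef := by
  have h1 : 1 ≤ traceNorm M := by
    have := re_trace_mul_le_traceNorm hM Matrix.PosSemidef.one (by simpa using .zero)
    simpa [ht] using this
  apply posSemidef_of_traceNorm_eq hM
  rw [ht, Complex.one_re]
  -- `Real.logb` also vanishes at 0 and -1; the bound 1 ≤ ‖M‖ excludes these.
  rcases Real.logb_eq_zero.mp h with h | h | h | h | h | h <;> linarith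

/-! ### Product Kraus decompositions and partial transposition. -/

theorem krausMap_comp_krausMap {P Q R : Type} [Fintype P] [Fintype Q] (K : Matrix Q P ℂ)
    (L : Matrix R Q ℂ) : krausMap L ∘ₗ krausMap K = krausMap (L * K) := by
  ext1 M
  simp [krausMap, Matrix.mul_assoc]

theorem krausMap_apply {P Q : Type} [Fintype P] (K : Matrix Q P ℂ) (M : Matrix P P ℂ) :
    krausMap K M = K * M * Kᴴ := rfl

theorem sum_sigma_conjTranspose_mul_self {ι P : Type} [Fintype ι] [Fintype P] [DecidableEq P]
    {R : Type} [Fintype R] {Z : ι → Type} [∀ i, Fintype (Z i)] [∀ i, DecidableEq (Z i)]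
    {J : ι → Type} [∀ i, Fintype (J i)] (T : ∀ i, J i → Matrix R (Z i) ℂ)
    (hT : ∀ i, ∑ j, (T i j)ᴴ * T i j = 1) (V : ∀ i, Matrix (Z i) P ℂ)
    (hV : ∑ i, (V i)ᴴ * V i = 1) :
    ∑ k : Σ i, J i, (T k.1 k.2 * V k.1)ᴴ * (T k.1 k.2 * V k.1) = 1 := by
  rw [Fintype.sum_sigma, ← hV]
  refine Finset.sum_congr rfl fun i _ => ?_
  have : ∀ j, (T i j * V i)ᴴ * (T i j * V i) = (V i)ᴴ * ((T i j)ᴴ * T i j) * V i := fun j => by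
    simp only [Matrix.conjTranspose_mul, Matrix.mul_assoc]
  simp only [this, ← Matrix.sum_mul, ← Matrix.mul_sum, hT, Matrix.mul_one]

/-- An LOCC protocol is a trace preserving sum of product Kraus maps. -/
theorem IsLOCC.exists_kraus {X' Y' : Type} [Fintype X'] [DecidableEq X'] [Fintype Y']
    [DecidableEq Y'] {X Y : Type} [Fintype X] [DecidableEq X] [Fintype Y] [DecidableEq Y]
    {Λ : Matrix (X × Y) (X × Y) ℂ →ₗ[ℂ] Matrix (X' × Y') (X' × Y') ℂ} (h : IsLOCC Λ) :
    ∃ (J : Type) (_ : Fintype J) (K : J → Matrix X' X ℂ) (L : J → Matrix Y' Y ℂ),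
      Λ = ∑ j, krausMap (K j ⊗ₖ L j) ∧ ∑ j, (K j ⊗ₖ L j)ᴴ * (K j ⊗ₖ L j) = 1 := by
  induction h with
  | refl =>
    refine ⟨Unit, inferInstance, fun _ => 1, fun _ => 1, ?_, by simp⟩
    ext1 M
    simp [krausMap_apply]
  | @fst X Y _ _ _ _ ι _ Z _ _ V hV Λ _ ih =>
    choose J hJ K L hΛ hKL using ih
    have e : ∀ k : Σ i, J i, (K k.1 k.2 * V k.1) ⊗ₖ L k.1 k.2
        = (K k.1 k.2 ⊗ₖ L k.1 k.2) * (V k.1 ⊗ₖ (1 : Matrix Y Y ℂ)) := fun k => by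
      rw [← Matrix.mul_kronecker_mul, Matrix.mul_one]
    refine ⟨Σ i, J i, inferInstance, fun k => K k.1 k.2 * V k.1, fun k => L k.1 k.2, ?_, ?_⟩
    · rw [Fintype.sum_sigma]
      refine Finset.sum_congr rfl fun i _ => ?_
      rw [hΛ i]
      ext1 M
      simp only [LinearMap.comp_apply, LinearMap.sum_apply]
      refine Finset.sum_congr rfl fun j _ => ?_
      rw [← LinearMap.comp_apply, krausMap_comp_krausMap]
      exact congrArg (krausMap · M) (e ⟨i, j⟩).symm
    · simp only [e]
      refine sum_sigma_conjTranspose_mul_self (fun i j => K i j ⊗ₖ L i j) hKL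
        (fun i => V i ⊗ₖ (1 : Matrix Y Y ℂ)) ?_
      simp only [Matrix.conjTranspose_kronecker, ← Matrix.mul_kronecker_mul,
        Matrix.conjTranspose_one, Matrix.mul_one]
      rw [← Matrix.one_kronecker_one, ← hV]
      ext p q
      simp [Matrix.sum_apply, Finset.sum_mul]
  | @snd X Y _ _ _ _ ι _ Z _ _ V hV Λ _ ih =>
    choose J hJ K L hΛ hKL using ih
    have e : ∀ k : Σ i, J i, K k.1 k.2 ⊗ₖ (L k.1 k.2 * V k.1)
        = (K k.1 k.2 ⊗ₖ L k.1 k.2) * ((1 : Matrix X X ℂ) ⊗ₖ V k.1) := fun k => by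
      rw [← Matrix.mul_kronecker_mul, Matrix.mul_one]
    refine ⟨Σ i, J i, inferInstance, fun k => K k.1 k.2, fun k => L k.1 k.2 * V k.1, ?_, ?_⟩
    · rw [Fintype.sum_sigma]
      refine Finset.sum_congr rfl fun i _ => ?_
      rw [hΛ i]
      ext1 M
      simp only [LinearMap.comp_apply, LinearMap.sum_apply]
      refine Finset.sum_congr rfl fun j _ => ?_
      rw [← LinearMap.comp_apply, krausMap_comp_krausMap]
      exact congrArg (krausMap · M) (e ⟨i, j⟩).symm
    · simp only [e]
      refine sum_sigma_conjTranspose_mul_self (fun i j => K i j ⊗ₖ L i j) hKL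
        (fun i => (1 : Matrix X X ℂ) ⊗ₖ V i) ?_
      simp only [Matrix.conjTranspose_kronecker, ← Matrix.mul_kronecker_mul,
        Matrix.conjTranspose_one, Matrix.mul_one]
      rw [← Matrix.one_kronecker_one, ← hV]
      ext p q
      simp [Matrix.sum_apply, Finset.mul_sum]

theorem trace_sum_kraus {J P Q : Type} [Fintype J] [Fintype P] [DecidableEq P] [Fintype Q]
    {T : J → Matrix Q P ℂ} (hT : ∑ j, (T j)ᴴ * T j = 1) (M : Matrix P P ℂ) :
    (∑ j, T j * M * (T j)ᴴ).trace = M.trace := by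
  have : ∀ j, (T j * M * (T j)ᴴ).trace = ((T j)ᴴ * T j * M).trace := fun j => by
    rw [Matrix.trace_mul_comm, Matrix.mul_assoc]
  rw [Matrix.trace_sum]
  simp only [this]
  rw [← Matrix.trace_sum, ← Matrix.sum_mul, hT, Matrix.one_mul]

/-- Partial transposition only replaces K by its complex conjugate, so a product Kraus map remains
completely positive after it. This is why LOCC preserves PPT. -/
theorem partialTranspose_kronecker_conj {X Y X' Y' : Type} [Fintype X] [Fintype Y]
    (K : Matrix X' X ℂ) (L : Matrix Y' Y ℂ) (M : Matrix (X × Y) (X × Y) ℂ) :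
    partialTranspose ((K ⊗ₖ L) * M * (K ⊗ₖ L)ᴴ)
      = (K.map star ⊗ₖ L) * partialTranspose M * (K.map star ⊗ₖ L)ᴴ := by
  ext p q
  simp only [partialTranspose, Matrix.of_apply, Matrix.mul_apply, Finset.sum_mul,
    Matrix.conjTranspose_apply, Matrix.kroneckerMap_apply, Matrix.map_apply]
  rw [← Fintype.sum_prod_type', ← Fintype.sum_prod_type']
  refine Fintype.sum_equiv
    { toFun := fun u => ((u.2.1, u.1.2), (u.1.1, u.2.2))
      invFun := fun u => ((u.2.1, u.1.2), (u.1.1, u.2.2))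
      left_inv := fun _ => rfl
      right_inv := fun _ => rfl } _ _ fun u => ?_
  simp only [Equiv.coe_fn_mk, star_mul', star_star]
  ring

theorem partialTranspose_sum {J X Y : Type} [Fintype J] (M : J → Matrix (X × Y) (X × Y) ℂ) :
    partialTranspose (∑ j, M j) = ∑ j, partialTranspose (M j) := by
  ext p q
  simp [partialTranspose, Matrix.sum_apply]

theorem isPPT_sum_kraus {J X Y X' Y' : Type} [Fintype J] [Fintype X] [Fintype Y] [Finite X']
    [Finite Y']
    (K : J → Matrix X' X ℂ) (L : J → Matrix Y' Y ℂ) {M : Matrix (X × Y) (X × Y) ℂ}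
    (hM : IsPPT M) : IsPPT (∑ j, (K j ⊗ₖ L j) * M * (K j ⊗ₖ L j)ᴴ) := by
  rw [IsPPT, partialTranspose_sum]
  refine Matrix.posSemidef_sum _ fun j _ => ?_
  rw [partialTranspose_kronecker_conj]
  exact hM.mul_mul_conjTranspose_same _

theorem posSemidef_sum_kraus {J P Q : Type} [Fintype J] [Fintype P] [Finite Q]
    (T : J → Matrix Q P ℂ) {M : Matrix P P ℂ} (hM : M.PosSemidef) :
    (∑ j, T j * M * (T j)ᴴ).PosSemidef :=
  Matrix.posSemidef_sum _ fun j _ => hM.mul_mul_conjTranspose_same (T j)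

section LOCC

variable {X Y X' Y' : Type} [Fintype X] [DecidableEq X] [Fintype Y] [DecidableEq Y]
  [Fintype X'] [DecidableEq X'] [Fintype Y'] [DecidableEq Y']
  {Λ : Matrix (X × Y) (X × Y) ℂ →ₗ[ℂ] Matrix (X' × Y') (X' × Y') ℂ}

theorem IsLOCC.isState (h : IsLOCC Λ) {M : Matrix (X × Y) (X × Y) ℂ} (hM : IsState M) :
    IsState (Λ M) := by
  obtain ⟨J, _, K, L, rfl, hKL⟩ := h.exists_kraus
  simp only [LinearMap.sum_apply, krausMap_apply]
  exact ⟨posSemidef_sum_kraus _ hM.1, (trace_sum_kraus hKL M).trans hM.2⟩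

theorem IsLOCC.isPPT (h : IsLOCC Λ) {M : Matrix (X × Y) (X × Y) ℂ} (hM : IsPPT M) :
    IsPPT (Λ M) := by
  obtain ⟨J, _, K, L, rfl, -⟩ := h.exists_kraus
  simp only [LinearMap.sum_apply, krausMap_apply]
  exact isPPT_sum_kraus K L hM

/-- An effect after an LOCC protocol is an effect before it (the Heisenberg picture). -/
theorem IsLOCC.exists_effect (h : IsLOCC Λ) {F : Matrix (X' × Y') (X' × Y') ℂ}
    (hF : F.PosSemidef) (hF' : (1 - F).PosSemidef) :
    ∃ E : Matrix (X × Y) (X × Y) ℂ, E.PosSemidef ∧ (1 - E).PosSemidef ∧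
      ∀ M, (E * M).trace = (F * Λ M).trace := by
  obtain ⟨J, _, K, L, rfl, hKL⟩ := h.exists_kraus
  refine ⟨∑ j, (K j ⊗ₖ L j)ᴴ * F * (K j ⊗ₖ L j),
    Matrix.posSemidef_sum _ fun j _ => hF.conjTranspose_mul_mul_same _, ?_, fun M => ?_⟩
  -- The dual map is unital by trace preservation, so it sends 1 - F to 1 - E.
  · have e : 1 - ∑ j, (K j ⊗ₖ L j)ᴴ * F * (K j ⊗ₖ L j)
        = ∑ j, (K j ⊗ₖ L j)ᴴ * (1 - F) * (K j ⊗ₖ L j) := by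
      simp only [Matrix.mul_sub, Matrix.sub_mul, Matrix.mul_one, Finset.sum_sub_distrib, hKL]
    rw [e]
    exact Matrix.posSemidef_sum _ fun j _ => hF'.conjTranspose_mul_mul_same _
  · simp only [LinearMap.sum_apply, krausMap_apply, Matrix.sum_mul, Matrix.mul_sum,
      Matrix.trace_sum]
    refine Finset.sum_congr rfl fun j _ => ?_
    rw [Matrix.mul_assoc, Matrix.mul_assoc, Matrix.trace_mul_comm]
    simp only [Matrix.mul_assoc]

end LOCC

/-! ### Preservation of PPT in the presence of a spectator. -/

/-- `Λ` maps states on `SX : Y` with positive partial transpose to such states. -/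
def PreservesPPTStates (S : Type) [Fintype S] {X Y X' Y' : Type} [Fintype X] [Fintype Y]
    [Fintype X'] [Fintype Y']
    (Λ : Matrix (X × Y) (X × Y) ℂ →ₗ[ℂ] Matrix (X' × Y') (X' × Y') ℂ) : Prop :=
  ∀ M : Matrix (S × (X × Y)) (S × (X × Y)) ℂ, IsState M → IsPPT (groupABvsC M) →
    IsState (idTensor S Λ M) ∧ IsPPT (groupABvsC (idTensor S Λ M))

theorem idTensor_sum_krausMap {J S P Q : Type} [Fintype J] [Fintype S] [DecidableEq S] [Fintype P]
    (T : J → Matrix Q P ℂ) (M : Matrix (S × P) (S × P) ℂ) :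
    idTensor S (∑ j, krausMap (T j)) M
      = ∑ j, ((1 : Matrix S S ℂ) ⊗ₖ T j) * M * ((1 : Matrix S S ℂ) ⊗ₖ T j)ᴴ := by
  ext u v
  simp only [idTensor, Matrix.of_apply, LinearMap.sum_apply, krausMap_apply, Matrix.sum_apply]
  refine Finset.sum_congr rfl fun j _ => ?_
  simp [Matrix.mul_apply, Fintype.sum_prod_type, Matrix.one_apply, Matrix.kroneckerMap_apply,
    apply_ite (starRingEnd ℂ)]

/-- The extended Kraus operators (1 ⊗ K) ⊗ L are still products across SX : Y. -/
theorem IsLOCC.preservesPPTStates (S : Type) [Fintype S] [DecidableEq S]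
    {X Y X' Y' : Type} [Fintype X] [DecidableEq X] [Fintype Y] [DecidableEq Y]
    [Fintype X'] [DecidableEq X'] [Fintype Y'] [DecidableEq Y']
    {Λ : Matrix (X × Y) (X × Y) ℂ →ₗ[ℂ] Matrix (X' × Y') (X' × Y') ℂ} (h : IsLOCC Λ) :
    PreservesPPTStates S Λ := by
  intro M hM hP
  obtain ⟨J, _, K, L, rfl, hKL⟩ := h.exists_kraus
  rw [idTensor_sum_krausMap]
  refine ⟨⟨posSemidef_sum_kraus _ hM.1, (trace_sum_kraus ?_ M).trans hM.2⟩, ?_⟩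
  · simp only [Matrix.conjTranspose_kronecker, ← Matrix.mul_kronecker_mul,
      Matrix.conjTranspose_one, Matrix.mul_one] at hKL ⊢
    rw [← Matrix.one_kronecker_one, ← hKL]
    ext p q
    simp [Matrix.sum_apply, Finset.mul_sum]
  · have e : groupABvsC (∑ j, ((1 : Matrix S S ℂ) ⊗ₖ (K j ⊗ₖ L j)) * M
          * ((1 : Matrix S S ℂ) ⊗ₖ (K j ⊗ₖ L j))ᴴ)
        = ∑ j, (((1 : Matrix S S ℂ) ⊗ₖ K j) ⊗ₖ L j) * groupABvsC M
          * (((1 : Matrix S S ℂ) ⊗ₖ K j) ⊗ₖ L j)ᴴ := by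
      have : ∀ j, ((1 : Matrix S S ℂ) ⊗ₖ K j) ⊗ₖ L j
          = ((1 : Matrix S S ℂ) ⊗ₖ (K j ⊗ₖ L j)).submatrix (Equiv.prodAssoc S X' Y')
            (Equiv.prodAssoc S X Y) := fun j => by
        ext p q
        simp [Matrix.kroneckerMap_apply, mul_assoc]
      simp only [this, groupABvsC, Matrix.conjTranspose_submatrix, Matrix.submatrix_mul_equiv]
      ext p q
      simp [Matrix.sum_apply]
    rw [e]
    exact isPPT_sum_kraus _ _ hP

theorem trace_submatrix_equiv {P Q : Type} [Fintype P] [Fintype Q] (M : Matrix Q Q ℂ)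
    (e : P ≃ Q) : (M.submatrix e e).trace = M.trace :=
  e.sum_comp fun q => M q q

theorem IsState.submatrix_equiv {P Q : Type} [Fintype P] [Fintype Q] {M : Matrix Q Q ℂ}
    (hM : IsState M) (e : P ≃ Q) : IsState (M.submatrix e e) :=
  ⟨hM.1.submatrix e, (trace_submatrix_equiv M e).trans hM.2⟩

theorem IsState.kronecker {P Q : Type} [Fintype P] [Fintype Q] {M : Matrix P P ℂ}
    {N : Matrix Q Q ℂ} (hM : IsState M) (hN : IsState N) : IsState (M ⊗ₖ N) :=
  ⟨hM.1.kronecker hN.1, by rw [Matrix.trace_kronecker, hM.2, hN.2, mul_one]⟩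

/-- The sum of diagonal blocks is a partial trace over J, wherever J sits inside Q. -/
theorem trace_sum_submatrix {J P Q : Type} [Fintype J] [Fintype P] [Fintype Q] (M : Matrix Q Q ℂ)
    (e : J × P ≃ Q) : (∑ j, M.submatrix (fun p => e (j, p)) fun p => e (j, p)).trace = M.trace := by
  rw [← trace_submatrix_equiv M e, Matrix.trace_sum, Matrix.trace, Fintype.sum_prod_type]
  rfl

theorem IsState.sum_submatrix {J P Q : Type} [Fintype J] [Fintype P] [Fintype Q] {M : Matrix Q Q ℂ}
    (hM : IsState M) (e : J × P ≃ Q) :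
    IsState (∑ j, M.submatrix (fun p => e (j, p)) fun p => e (j, p)) :=
  ⟨Matrix.posSemidef_sum _ fun _ _ => hM.1.submatrix _, (trace_sum_submatrix M e).trans hM.2⟩

/-- The resource is harmless: the partial transpose of M ⊗ μ is the tensor product of the two
partial transposes. Tracing out the ancillas afterwards sums diagonal blocks of a positive matrix.
-/
theorem IsPPTAssistedLOCC.preservesPPTStates (S : Type) [Fintype S] [DecidableEq S]
    {X Y : Type} [Fintype X] [DecidableEq X] [Fintype Y] [DecidableEq Y]
    {Λ : Matrix (X × Y) (X × Y) ℂ →ₗ[ℂ] Matrix (X × Y) (X × Y) ℂ} (h : IsPPTAssistedLOCC Λ) :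
    PreservesPPTStates S Λ := by
  intro M hM hP
  obtain ⟨X₁, Y₁, _, _, _, _, μ, Λ₀, hμ, hμP, hΛ₀, hΛ⟩ := h
  let g : S × ((X × X₁) × (Y × Y₁)) ≃ (S × (X × Y)) × (X₁ × Y₁) :=
    ((Equiv.refl S).prodCongr (Equiv.prodProdProdComm X X₁ Y Y₁)).trans
      (Equiv.prodAssoc S (X × Y) (X₁ × Y₁)).symm
  let e : (X₁ × Y₁) × (S × (X × Y)) ≃ S × ((X × X₁) × (Y × Y₁)) :=
    (Equiv.prodComm _ _).trans g.symm
  set N := (M ⊗ₖ μ).submatrix g g with hN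
  have hNs : IsState N := (hM.kronecker hμ).submatrix_equiv g
  have hNP : IsPPT (groupABvsC N) :=
    (hP.kronecker hμP).submatrix
      fun u : (S × (X × X₁)) × (Y × Y₁) => (((u.1.1, u.1.2.1), u.2.1), (u.1.2.2, u.2.2))
  obtain ⟨h1, h2⟩ := hΛ₀.preservesPPTStates S N hNs hNP
  have key : idTensor S Λ M
      = ∑ j, (idTensor S Λ₀ N).submatrix (fun p => e (j, p)) fun p => e (j, p) := by
    ext u v
    rw [Matrix.sum_apply]
    simp only [idTensor, Matrix.of_apply, hΛ]
    rfl
  rw [key]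
  refine ⟨h1.sum_submatrix e, ?_⟩
  have e2 : partialTranspose (groupABvsC
        (∑ j, (idTensor S Λ₀ N).submatrix (fun p => e (j, p)) fun p => e (j, p)))
      = ∑ j : X₁ × Y₁, (partialTranspose (groupABvsC (idTensor S Λ₀ N))).submatrix
        (fun p => ((p.1.1, (p.1.2, j.1)), (p.2, j.2)))
        fun p => ((p.1.1, (p.1.2, j.1)), (p.2, j.2)) := by
    ext u v
    simp only [partialTranspose, groupABvsC, Matrix.submatrix_apply, Matrix.of_apply,
      Matrix.sum_apply]
    rfl
  rw [IsPPT, e2]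
  exact Matrix.posSemidef_sum _ fun _ _ => Matrix.PosSemidef.submatrix h2 _

/-- The register is local to Charlie, so the input is PPT across AB : CR; Λ keeps it so, and tracing
out B restricts the cut to A : CR. -/
theorem isState_isPPT_finalState {A B C : Type} [Fintype A] [Fintype B] [Fintype C]
    {ρ : Matrix (A × B × C) (A × B × C) ℂ} (hρ : IsState ρ) (hP : IsPPT (groupABvsC ρ))
    {τ : Matrix B B ℂ} (hτ : IsState τ)
    {Λ : Matrix (B × (C × B)) (B × (C × B)) ℂ →ₗ[ℂ] Matrix (B × (C × B)) (B × (C × B)) ℂ}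
    (hΛ : PreservesPPTStates A Λ) :
    IsState (finalState ρ τ Λ) ∧ IsPPT (finalState ρ τ Λ) := by
  let g : A × (B × (C × B)) ≃ (A × B × C) × B :=
    { toFun := fun p => ((p.1, p.2.1, p.2.2.1), p.2.2.2)
      invFun := fun p => (p.1.1, (p.1.2.1, (p.1.2.2, p.2)))
      left_inv := fun _ => rfl
      right_inv := fun _ => rfl }
  let e : B × (A × (C × B)) ≃ A × (B × (C × B)) :=
    { toFun := fun p => (p.2.1, (p.1, p.2.2))
      invFun := fun p => (p.2.1, (p.1, p.2.2))
      left_inv := fun _ => rfl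
      right_inv := fun _ => rfl }
  have hW : IsState (withRegister ρ τ) := (hρ.kronecker hτ).submatrix_equiv g
  have hWP : IsPPT (groupABvsC (withRegister ρ τ)) :=
    (hP.kronecker hτ.1).submatrix
      fun u : (A × B) × (C × B) => ((u.1, u.2.1), u.2.2)
  obtain ⟨h1, h2⟩ := hΛ _ hW hWP
  have key : finalState ρ τ Λ = ∑ b,
      (idTensor A Λ (withRegister ρ τ)).submatrix (fun p => e (b, p)) fun p => e (b, p) := by
    ext u v
    rw [Matrix.sum_apply]
    rfl
  rw [key]
  refine ⟨h1.sum_submatrix e, ?_⟩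
  rw [IsPPT, partialTranspose_sum]
  refine Matrix.posSemidef_sum _ fun b _ => ?_
  have h3 := h2.submatrix fun p : A × (C × B) => ((p.1, b), p.2)
  exact h3

/-! ### Tensor powers of states. -/

/-- The `n`-th tensor power of an operator. -/
def tensorPow {X : Type} (n : ℕ) (M : Matrix X X ℂ) : Matrix (Fin n → X) (Fin n → X) ℂ :=
  Matrix.of fun x y => ∏ i, M (x i) (y i)

/-- A tensor power is the Hadamard product of the pullbacks of M along the n coordinates, so the
Schur product theorem applies. -/
theorem Matrix.PosSemidef.tensorPow {X : Type} [Fintype X] {M : Matrix X X ℂ}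
    (hM : M.PosSemidef) (n : ℕ) : (tensorPow n M).PosSemidef := by
  suffices h : ∀ s : Finset (Fin n),
      (Matrix.of fun x y : Fin n → X => ∏ i ∈ s, M (x i) (y i)).PosSemidef from h Finset.univ
  intro s
  induction s using Finset.induction_on with
  | empty =>
    have := Matrix.posSemidef_vecMulVec_self_star (fun _ : Fin n → X => (1 : ℂ))
    convert this using 1
    ext x y
    simp [Matrix.vecMulVec_apply]
  | insert a s ha ih =>
    have e : (Matrix.of fun x y : Fin n → X => ∏ i ∈ insert a s, M (x i) (y i))
        = (M.submatrix (fun x : Fin n → X => x a) fun x => x a).hadamard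
          (Matrix.of fun x y : Fin n → X => ∏ i ∈ s, M (x i) (y i)) := by
      ext x y
      simp [Finset.prod_insert ha]
    rw [e]
    exact (hM.submatrix fun x : Fin n → X => x a).hadamard ih

theorem IsState.tensorPow {X : Type} [Fintype X] {M : Matrix X X ℂ} (hM : IsState M) (n : ℕ) :
    IsState (tensorPow n M) := by
  refine ⟨hM.1.tensorPow n, ?_⟩
  have h := Finset.prod_univ_sum (fun _ : Fin n => (Finset.univ : Finset X)) fun _ x => M x x
  have ht : ∑ x, M x x = 1 := hM.2
  simp only [ht, Finset.prod_const_one, Fintype.piFinset_univ] at h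
  exact h.symm

theorem IsState.tensorPow₂ {X Y : Type} [Fintype X] [Fintype Y]
    {ρ : Matrix (X × Y) (X × Y) ℂ} (hρ : IsState ρ) (n : ℕ) : IsState (tensorPow₂ n ρ) :=
  (hρ.tensorPow n).submatrix_equiv
    (Equiv.arrowProdEquivProdArrow (Fin n) (fun _ => X) fun _ => Y).symm

theorem IsState.tensorPow₃ {A B C : Type} [Fintype A] [Fintype B] [Fintype C]
    {ρ : Matrix (A × B × C) (A × B × C) ℂ} (hρ : IsState ρ) (n : ℕ) : IsState (tensorPow₃ n ρ) :=
  (hρ.tensorPow n).submatrix_equiv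
    { toFun := fun p i => (p.1 i, p.2.1 i, p.2.2 i)
      invFun := fun f => (fun i => (f i).1, fun i => (f i).2.1, fun i => (f i).2.2)
      left_inv := fun _ => rfl
      right_inv := fun _ => rfl }

theorem isPPT_groupABvsC_tensorPow₃ {A B C : Type} [Fintype A] [Fintype B] [Fintype C]
    {ρ : Matrix (A × B × C) (A × B × C) ℂ} (hρ : IsPPT (groupABvsC ρ)) (n : ℕ) :
    IsPPT (groupABvsC (tensorPow₃ n ρ)) :=
  (Matrix.PosSemidef.tensorPow hρ n).submatrix
    fun (p : ((Fin n → A) × (Fin n → B)) × (Fin n → C)) i => ((p.1.1 i, p.1.2 i), p.2 i)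

/-! ### The maximally entangled state -/

/-- The maximally entangled state on two systems with basis `D`. -/
noncomputable def maxEntangled (D : Type) [Fintype D] [DecidableEq D] :
    Matrix (D × D) (D × D) ℂ :=
  Matrix.of fun p q => if p.1 = p.2 ∧ q.1 = q.2 then (Fintype.card D : ℂ)⁻¹ else 0

theorem phiPlus_apply (p q : Fin 2 × Fin 2) :
    phiPlus p q = if p.1 = p.2 ∧ q.1 = q.2 then (2 : ℂ)⁻¹ else 0 := by
  have h : ((√2 : ℝ) : ℂ)⁻¹ * ((√2 : ℝ) : ℂ)⁻¹ = 2⁻¹ := by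
    rw [← mul_inv, ← Complex.ofReal_mul, Real.mul_self_sqrt (by norm_num)]
    norm_num
  by_cases hp : p.1 = p.2 <;> by_cases hq : q.1 = q.2 <;>
    simp [phiPlus, Matrix.vecMulVec_apply, hp, hq, h]

theorem tensorPow₂_phiPlus (m : ℕ) : tensorPow₂ m phiPlus = maxEntangled (Fin m → Fin 2) := by
  ext p q
  simp only [tensorPow₂, maxEntangled, Matrix.of_apply, phiPlus_apply]
  have := Finset.prod_ite_zero (s := (Finset.univ : Finset (Fin m)))
    (p := fun i => p.1 i = p.2 i ∧ q.1 i = q.2 i) (f := fun _ => (2 : ℂ)⁻¹)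
  rw [this]
  simp [funext_iff, forall_and]

section maxEntangled

variable {D : Type} [Fintype D] [DecidableEq D]

theorem maxEntangled_isHermitian : (maxEntangled D).IsHermitian := by
  ext p q
  simp [maxEntangled, apply_ite (starRingEnd ℂ), and_comm]

theorem maxEntangled_mul_self [Nonempty D] : maxEntangled D * maxEntangled D = maxEntangled D := by
  ext p q
  have hD : (Fintype.card D : ℂ) ≠ 0 := Nat.cast_ne_zero.mpr Fintype.card_ne_zero
  by_cases hp : p.1 = p.2 <;> by_cases hq : q.1 = q.2 <;>
    simp [maxEntangled, Matrix.mul_apply, Fintype.sum_prod_type, hp, hq, hD]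

theorem trace_maxEntangled [Nonempty D] : (maxEntangled D).trace = 1 := by
  have hD : (Fintype.card D : ℂ) ≠ 0 := Nat.cast_ne_zero.mpr Fintype.card_ne_zero
  simp [maxEntangled, Matrix.trace, Fintype.sum_prod_type, hD]

theorem Matrix.IsHermitian.posSemidef_of_mul_self {X : Type} [Fintype X] {P : Matrix X X ℂ}
    (hP : P.IsHermitian) (h : P * P = P) : P.PosSemidef := by
  have := Matrix.posSemidef_conjTranspose_mul_self P
  rwa [hP.eq, h] at this

theorem Matrix.IsHermitian.posSemidef_one_sub {X : Type} [Fintype X] [DecidableEq X]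
    {P : Matrix X X ℂ} (hP : P.IsHermitian) (h : P * P = P) : (1 - P).PosSemidef :=
  (Matrix.isHermitian_one.sub hP).posSemidef_of_mul_self (by
    rw [Matrix.mul_sub, Matrix.sub_mul, Matrix.sub_mul, h]
    simp)

/-- The partial transpose of Φ is S/d with S the swap, a Hermitian involution, so S ≤ 1. -/
theorem posSemidef_sub_partialTranspose_maxEntangled :
    ((Fintype.card D : ℂ)⁻¹ • 1 - partialTranspose (maxEntangled D)).PosSemidef := by
  set S : Matrix (D × D) (D × D) ℂ := Matrix.of fun p q => if q.1 = p.2 ∧ p.1 = q.2 then 1 else 0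
    with hS
  have hSH : S.IsHermitian := by
    ext p q
    simp [hS, apply_ite (starRingEnd ℂ), and_comm]
  have hSS : S * S = 1 := by
    ext ⟨a, b⟩ ⟨c, d⟩
    simp [hS, Matrix.mul_apply, Fintype.sum_prod_type, Matrix.one_apply, ite_and, eq_comm]
    split_ifs <;> rfl
  have h1 : (1 - S).PosSemidef := by
    -- 1 - S = (1 - S)²/2 because S² = 1.
    have h := (Matrix.posSemidef_conjTranspose_mul_self (1 - S)).smul
      (inv_nonneg.mpr zero_le_two : (0 : ℂ) ≤ 2⁻¹)
    convert h using 1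
    rw [Matrix.conjTranspose_sub, hSH.eq, Matrix.conjTranspose_one, Matrix.sub_mul, Matrix.mul_sub,
      Matrix.mul_sub, hSS]
    ext p q
    simp
    ring
  have h2 := h1.smul (inv_nonneg.mpr (Nat.cast_nonneg (Fintype.card D)) :
    (0 : ℂ) ≤ (Fintype.card D : ℂ)⁻¹)
  convert h2 using 1
  rw [smul_sub]
  congr 1
  ext p q
  simp [hS, partialTranspose, maxEntangled]

theorem trace_partialTranspose_mul {X Y : Type} [Fintype X] [Fintype Y]
    (M N : Matrix (X × Y) (X × Y) ℂ) :
    (partialTranspose M * partialTranspose N).trace = (M * N).trace := by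
  simp only [Matrix.trace, Matrix.diag_apply, Matrix.mul_apply]
  rw [← Fintype.sum_prod_type', ← Fintype.sum_prod_type']
  exact Fintype.sum_equiv
    { toFun := fun u => ((u.2.1, u.1.2), (u.1.1, u.2.2))
      invFun := fun u => ((u.2.1, u.1.2), (u.1.1, u.2.2))
      left_inv := fun _ => rfl
      right_inv := fun _ => rfl } _ _ fun u => rfl

theorem trace_partialTranspose {X Y : Type} [Fintype X] [Fintype Y]
    (M : Matrix (X × Y) (X × Y) ℂ) : (partialTranspose M).trace = M.trace := rfl

theorem Matrix.IsHermitian.partialTranspose {X Y : Type} {M : Matrix (X × Y) (X × Y) ℂ}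
    (hM : M.IsHermitian) : (partialTranspose M).IsHermitian := by
  ext p q
  exact hM.apply (q.1, p.2) (p.1, q.2)

/-- A state with positive partial transpose has overlap at most `1 / d` with the maximally
entangled state. -/
theorem re_trace_maxEntangled_mul_le {σ : Matrix (D × D) (D × D) ℂ} (hσ : σ.trace = 1)
    (hP : IsPPT σ) : (maxEntangled D * σ).trace.re ≤ (Fintype.card D : ℝ)⁻¹ := by
  have h := (Complex.le_def.mp
    (posSemidef_sub_partialTranspose_maxEntangled.trace_mul_nonneg hP)).1
  rw [Matrix.sub_mul, Matrix.trace_sub, trace_partialTranspose_mul, Matrix.smul_mul,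
    Matrix.one_mul, Matrix.trace_smul, trace_partialTranspose, hσ] at h
  simp only [Complex.zero_re, smul_eq_mul, mul_one, Complex.sub_re] at h
  have e : ((Fintype.card D : ℂ)⁻¹).re = (Fintype.card D : ℝ)⁻¹ := by
    rw [← Complex.ofReal_natCast, ← Complex.ofReal_inv, Complex.ofReal_re]
  linarith

end maxEntangled

/-! ### Merging -/

/-- In each term of the classical fidelity, one of the two probabilities is small and the other is
at most 1. -/
theorem fidelity_le_of_test {X : Type} [Fintype X] [DecidableEq X] {ρ σ E : Matrix X X ℂ}
    (hρ : IsState ρ) (hσ : IsState σ) (hE : E.PosSemidef) (hE' : (1 - E).PosSemidef) {a b : ℝ}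
    (ha : (E * ρ).trace.re ≤ a) (hb : 1 - b ≤ (E * σ).trace.re) :
    fidelity ρ σ ≤ √a + √b := by
  have h1 : ∀ ν : Matrix X X ℂ, IsState ν →
      ((1 - E) * ν).trace.re = 1 - (E * ν).trace.re := fun ν hν => by
    rw [Matrix.sub_mul, Matrix.one_mul, Matrix.trace_sub, hν.2, Complex.sub_re, Complex.one_re]
  have hσ' := (Complex.le_def.mp (hE'.trace_mul_nonneg hσ.1)).1
  have hρ' := (Complex.le_def.mp (hE.trace_mul_nonneg hρ.1)).1
  rw [h1 σ hσ, Complex.zero_re] at hσ'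
  rw [Complex.zero_re] at hρ'
  refine (fidelity_le hρ.1 hσ.1 hE hE').trans (add_le_add ?_ ?_)
  · refine (mul_le_mul (Real.sqrt_le_sqrt ha) (Real.sqrt_le_one.mpr (by linarith))
      (Real.sqrt_nonneg _) (Real.sqrt_nonneg _)).trans_eq (mul_one _)
  · rw [h1 ρ hρ, h1 σ hσ]
    refine (mul_le_mul (Real.sqrt_le_one.mpr (by linarith))
      (Real.sqrt_le_sqrt (by linarith : _ ≤ b)) (Real.sqrt_nonneg _) zero_le_one).trans_eq
        (one_mul _)

/-- If LOCC takes a state to within `traceDist` of a maximally entangled state, then its fidelity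
with any state of positive partial transpose is small. -/
theorem fidelity_le_of_isLOCC {X Y D : Type} [Fintype X] [DecidableEq X] [Fintype Y]
    [DecidableEq Y] [Fintype D] [DecidableEq D] [Nonempty D]
    {Λ : Matrix (X × Y) (X × Y) ℂ →ₗ[ℂ] Matrix (D × D) (D × D) ℂ} (hΛ : IsLOCC Λ)
    {σ : Matrix (X × Y) (X × Y) ℂ} (hσ : IsState σ) {Y₁ : Type} [Fintype Y₁] [DecidableEq Y₁]
    (e : Y₁ ≃ Y) {ν : Matrix (X × Y₁) (X × Y₁) ℂ} (hν : IsState ν) (hP : IsPPT ν) :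
    fidelity ν (σ.submatrix ((Equiv.refl X).prodCongr e) ((Equiv.refl X).prodCongr e))
      ≤ √((Fintype.card D : ℝ)⁻¹) + √(2 * traceDist (Λ σ) (maxEntangled D)) := by
  set g : X × Y₁ ≃ X × Y := (Equiv.refl X).prodCongr e with hg
  have hΦ := (maxEntangled_isHermitian (D := D)).posSemidef_of_mul_self maxEntangled_mul_self
  have hΦ' := (maxEntangled_isHermitian (D := D)).posSemidef_one_sub maxEntangled_mul_self
  obtain ⟨E, hE, hE', hEΛ⟩ := hΛ.exists_effect hΦ hΦ'
  have hν₁ : IsState (ν.submatrix g.symm g.symm) := hν.submatrix_equiv g.symm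
  have hP₁ : IsPPT (ν.submatrix g.symm g.symm) := Matrix.PosSemidef.submatrix hP g.symm
  have hE₁ : (1 - E.submatrix g g).PosSemidef := by
    rw [← Matrix.submatrix_one_equiv g]
    exact hE'.submatrix g
  refine fidelity_le_of_test hν (hσ.submatrix_equiv g) (hE.submatrix g) hE₁ ?_ ?_
  · have e1 : (E.submatrix g g * ν).trace = (E * ν.submatrix g.symm g.symm).trace := by
      rw [← trace_submatrix_equiv (E * _) g, ← Matrix.submatrix_mul_equiv _ _ _ g]
      simp
    rw [e1, hEΛ]
    exact re_trace_maxEntangled_mul_le (hΛ.isState hν₁).2 (hΛ.isPPT hP₁)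
  · have hN := hΛ.isState hσ
    rw [Matrix.submatrix_mul_equiv, trace_submatrix_equiv, hEΛ]
    -- Testing Λσ - Φ with 1 - Φ gives 1 - Tr ΦΛσ ≤ ‖Λσ - Φ‖, which is twice `traceDist`.
    have h := re_trace_mul_le_traceNorm (hN.1.1.sub (maxEntangled_isHermitian (D := D))) hΦ'
      (by rwa [sub_sub_cancel])
    simp only [Matrix.mul_sub, Matrix.sub_mul, Matrix.one_mul, maxEntangled_mul_self,
      Matrix.trace_sub, Complex.sub_re, hN.2, trace_maxEntangled, Complex.one_re] at h
    rw [traceDist]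
    linarith

theorem isPPTAssistedLOCC_id {X Y : Type} [Fintype X] [DecidableEq X] [Fintype Y]
    [DecidableEq Y] :
    IsPPTAssistedLOCC (LinearMap.id : Matrix (X × Y) (X × Y) ℂ →ₗ[ℂ] _) := by
  have hμ : partialTranspose (1 : Matrix (Unit × Unit) (Unit × Unit) ℂ) = 1 := rfl
  refine ⟨Unit, Unit, inferInstance, inferInstance, inferInstance, inferInstance, 1,
    LinearMap.id, ⟨.one, by simp⟩, hμ ▸ .one, .refl, fun ρ => ?_⟩
  ext p q
  simp [traceSnd]

theorem exists_isState (X : Type) [Fintype X] [DecidableEq X] [Nonempty X] :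
    ∃ τ : Matrix X X ℂ, IsState τ := by
  obtain ⟨x⟩ := ‹Nonempty X›
  refine ⟨Matrix.diagonal (Pi.single x 1), .diagonal ?_, by simp⟩
  exact Pi.single_nonneg.mpr zero_le_one

/-- Treats both classes of operations at once: preservation of PPT gives the upper bound. The
identity belongs to the class so that the supremum is not over an empty family, where it would be
`⊥`. -/
theorem tendsto_mergingFidelity {A B C : Type} [Fintype A] [DecidableEq A] [Fintype B]
    [DecidableEq B] [Fintype C] [DecidableEq C] {ρ : Matrix (A × B × C) (A × B × C) ℂ}
    (hρ : IsState ρ) (hP : IsPPT (groupABvsC ρ)) {r : ℝ} (hr : 0 < r)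
    (hD : IsDistillationRate ρ r)
    (𝓛 : ∀ n, Set (Matrix ((Fin n → B) × ((Fin n → C) × (Fin n → B)))
      ((Fin n → B) × ((Fin n → C) × (Fin n → B))) ℂ →ₗ[ℂ]
        Matrix ((Fin n → B) × ((Fin n → C) × (Fin n → B)))
          ((Fin n → B) × ((Fin n → C) × (Fin n → B))) ℂ))
    (h𝓛 : ∀ n, ∀ Λ ∈ 𝓛 n, PreservesPPTStates (Fin n → A) Λ) (hid : ∀ n, LinearMap.id ∈ 𝓛 n) :
    Tendsto (fun n : ℕ => mergingFidelity (𝓛 n) (tensorPow₃ n ρ)) atTop (𝓝 0) := by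
  obtain ⟨-, Λ, hΛ, hlim⟩ := hD
  -- Needed for an initial register state to exist; unit trace rules out an empty basis.
  have hB : Nonempty B := by
    by_contra h
    rw [not_nonempty_iff] at h
    have := hρ.2
    simp [Matrix.trace] at this
  have hm : Tendsto (fun n : ℕ => ⌊n * r⌋₊) atTop atTop :=
    tendsto_nat_floor_atTop.comp (tendsto_natCast_atTop_atTop.atTop_mul_const hr)
  have hcard : Tendsto (fun n : ℕ => (Fintype.card (Fin ⌊n * r⌋₊ → Fin 2) : ℝ)⁻¹) atTop
      (𝓝 0) := by
    have := (tendsto_pow_atTop_nhds_zero_of_lt_one (r := (2 : ℝ)⁻¹) (by norm_num)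
      (by norm_num)).comp hm
    simpa [Function.comp_def] using this
  have hbound : Tendsto (fun n : ℕ => √((Fintype.card (Fin ⌊n * r⌋₊ → Fin 2) : ℝ)⁻¹)
      + √(2 * traceDist (Λ n (tensorPow₂ n ρ)) (tensorPow₂ ⌊n * r⌋₊ phiPlus))) atTop (𝓝 0) := by
    have := hcard.sqrt.add (hlim.const_mul 2).sqrt
    simpa using this
  refine tendsto_of_tendsto_of_tendsto_of_le_of_le tendsto_const_nhds
    (EReal.tendsto_coe.mpr hbound) (fun n => ?_) fun n => ?_
  · obtain ⟨τ, hτ⟩ := exists_isState (Fin n → B)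
    refine le_trans ?_ (le_iSup₂_of_le LinearMap.id (hid n) (le_iSup₂_of_le τ hτ le_rfl))
    exact EReal.coe_nonneg.mpr (fidelity_nonneg _ _)
  · refine iSup₂_le fun Ξ hΞ => iSup₂_le fun τ hτ => EReal.coe_le_coe_iff.mpr ?_
    obtain ⟨h1, h2⟩ := isState_isPPT_finalState (hρ.tensorPow₃ n)
      (isPPT_groupABvsC_tensorPow₃ hP n) hτ (h𝓛 n Ξ hΞ)
    -- Regroups Charlie's systems so that the target becomes ρ^{⊗n} on A : BC, the input of the
    -- distillation protocol.
    let e : (Fin n → C) × (Fin n → B) ≃ (Fin n → B × C) :=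
      (Equiv.prodComm _ _).trans
        (Equiv.arrowProdEquivProdArrow (Fin n) (fun _ => B) fun _ => C).symm
    have := fidelity_le_of_isLOCC (hΛ n) (hρ.tensorPow₂ n) e h1 h2
    rw [tensorPow₂_phiPlus]
    exact this

theorem mainTheorem3 {A B C : Type} [Fintype A] [DecidableEq A] [Fintype B] [DecidableEq B]
    [Fintype C] [DecidableEq C] (ρ : Matrix (A × B × C) (A × B × C) ℂ) (hρ : IsState ρ)
    (hD : distillableEntanglement ρ > (logNegativity (groupABvsC ρ) : EReal))
    (hE : logNegativity (groupABvsC ρ) = 0) :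
    Tendsto (fun n : ℕ => fidelityPPT (tensorPow₃ n ρ)) atTop (𝓝 0) ∧
      Tendsto (fun n : ℕ => fidelityLOCC (tensorPow₃ n ρ)) atTop (𝓝 0) := by
  have hG : IsState (groupABvsC ρ) := hρ.submatrix_equiv (Equiv.prodAssoc A B C)
  have hP : IsPPT (groupABvsC ρ) :=
    posSemidef_of_logb_traceNorm hG.1.1.partialTranspose hG.2 hE
  rw [hE, distillableEntanglement, gt_iff_lt, lt_iSup_iff] at hD
  obtain ⟨r, hr⟩ := hD
  obtain ⟨hrate, hr⟩ := lt_iSup_iff.mp hr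
  have hr0 : 0 < r := EReal.coe_lt_coe_iff.mp hr
  exact ⟨tendsto_mergingFidelity hρ hP hr0 hrate _
      (fun n Λ hΛ => IsPPTAssistedLOCC.preservesPPTStates _ hΛ) fun n => isPPTAssistedLOCC_id,
    tendsto_mergingFidelity hρ hP hr0 hrate _
      (fun n Λ hΛ => IsLOCC.preservesPPTStates _ hΛ) fun n => .refl⟩
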